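/- Let $n\ge 2$, let $u\in\mathbb{R}^n$ be a unit vector, and let $H=u^{\perp}$. Let $\mathcal{K}^n_n$ be the class of convex bodies (compact convex sets with nonempty interior) in $\mathbb{R}^n$, and let $\mathcal{L}^n$ be the class of $\mathcal{H}^n$-measurable subsets of $\mathbb{R}^n$ of finite $\mathcal{H}^n$-measure, where $\mathcal{H}^k$ is $k$-dimensional Hausdorff measure. Write $B(x,r)$ for the closed ball with center $x$ and radius $r>0$, and $K^{\dagger}$ for the reflection of $K$ in $H$. "Essentially" means up to a set of $\mathcal{H}^n$-measure zero. For $K\in\mathcal{K}^n_n$ and $t\in\mathbb{R}$ let $$K_t=(K-tu)\cap(K^{\dagger}+tu).$$ A map $\Diamond:\mathcal{K}^n_n\to\mathcal{L}^n$ is called - *monotonic* if, for $K,L\in\mathcal{K}^n_n$, $K\subset L$ essentially implies $\Diamond K\subset\Diamond L$ essentially; - *measure preserving* if $\mathcal{H}^n(\Diamond K)=\mathcal{H}^n(K)$ for all $K\in\mathcal{K}^n_n$; - *respecting $H$-cylinders* if, for all $K\in\mathcal{K}^n_n$, $x\in\mathbb{R}^n$ and $r>0$, $K\subset (B(x,r)\cap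 H)+H^{\perp}$ essentially implies $\Diamond K\subset (B(x,r)\cap H)+H^{\perp}$ essentially; - *mapping balls to balls* if for every $x\in\mathbb{R}^n$ and $r>0$ there are $x'\in\mathbb{R}^n$ and $r'>0$ with $\Diamond B(x,r)=B(x',r')$, essentially. A *contraction* is a function $\mathbb{R}\to\mathbb{R}$ that is Lipschitz with constant $1$. If $\Diamond$ has these four properties, then there is exactly one contraction $\varphi_{\Diamond}:\mathbb{R}\to\mathbb{R}$ such that, for all $x\in H$, $t\in\mathbb{R}$ and $r>0$, $\Diamond B(x+tu,r)=B(x+\varphi_{\Diamond}(t)u,r)$, essentially. Let $\Diamond:\mathcal{K}^n_n\to\mathcal{L}^n$ be any map and let $\varphi:\mathbb{R}\to\mathbb{R}$ be a contraction. The following are equivalent. (i) $\Diamond$ is monotonic, measure preserving, respects $H$-cylinders, and maps balls to balls, and $\varphi=\varphi_{\Diamond}$. (ii) For each $K\in\mathcal{K}^n_n$, $$\Diamond K=\bigcup_{t\in\mathbb{R}}\operatorname{int}\bigl(K_t+\varphi(t)u\bigr),\quad\text{essentially.}$$ (iii) For each $K\in\mathcal{K}^n_n$ and $\mathcal{H}^{n-1}$-almost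 all $x\in H$, $$(\Diamond K)\cap(H^{\perp}+x)=\bigl(K\cap(H^{\perp}+x)\bigr)+(\varphi(t_x)-t_x)u$$ up to a set of $\mathcal{H}^1$-measure zero, where $x+t_xu$ is the midpoint of $K\cap(H^{\perp}+x)$ (if $K\cap(H^{\perp}+x)=\emptyset$, the right-hand side is empty). -/

import Mathlib

open MeasureTheory Set
open scoped Pointwise

noncomputable section

namespace ChordMovement

/-- Euclidean `n`-space. -/
abbrev E (n : ℕ) : Type := EuclideanSpace ℝ (Fin n)

/-- `k`-dimensional Hausdorff measure, normalized to agree with Lebesgue measure on `ℝ^k`. -/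
abbrev haus {X : Type} [EMetricSpace X] [MeasurableSpace X] [BorelSpace X] (k : ℕ) : Measure X :=
  Measure.euclideanHausdorffMeasure k

/-- Convex bodies: nonempty compact convex sets with interior points. -/
abbrev Body (n : ℕ) : Type := {K : ConvexBody (E n) // (interior (K : Set (E n))).Nonempty}

/-- The underlying set of a convex body. -/
def Body.set {n : ℕ} (K : Body n) : Set (E n) := (K.1 : Set (E n))

/-- Measurable (with respect to the completed measure) sets of finite `n`-dimensional measure. -/
abbrev FinMeas (n : ℕ) : Type :=
  {A : Set (E n) // NullMeasurableSet A (haus n) ∧ haus n A < ⊤}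

/-- `A ⊆ B` up to a set of `n`-dimensional measure zero. -/
def EssSubset {n : ℕ} (A B : Set (E n)) : Prop := A ≤ᵐ[haus n] B

/-- `A = B` up to a set of `n`-dimensional measure zero. -/
def EssEq {n : ℕ} (A B : Set (E n)) : Prop := A =ᵐ[haus n] B

/-- The closed ball with center `x` and radius `r > 0`, as a convex body. -/
def ball {n : ℕ} (x : E n) (r : ℝ) (hr : 0 < r) : Body n :=
  ⟨{ carrier := Metric.closedBall x r
     convex' := convex_closedBall x r
     isCompact' := isCompact_closedBall x r
     nonempty' := ⟨x, Metric.mem_closedBall_self hr.le⟩ },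
   ⟨x, Metric.ball_subset_interior_closedBall (Metric.mem_ball_self hr)⟩⟩

/-- The subspace `H = u^⊥`. -/
abbrev hyp {n : ℕ} (u : E n) : Submodule ℝ (E n) := (Submodule.span ℝ {u})ᗮ

/-- The translate `A + v`. -/
def translate {n : ℕ} (A : Set (E n)) (v : E n) : Set (E n) := (fun y => y + v) '' A

def Monotonic {n : ℕ} (D : Body n → FinMeas n) : Prop :=
  ∀ K L : Body n, EssSubset K.set L.set → EssSubset (D K).1 (D L).1

def MeasPreserving {n : ℕ} (D : Body n → FinMeas n) : Prop :=
  ∀ K : Body n, haus n (D K).1 = haus n K.set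

/-- The cylinder `(B(x,r) ∩ H) + H^⊥`. -/
def cylinder {n : ℕ} (H : Submodule ℝ (E n)) (x : E n) (r : ℝ) : Set (E n) :=
  (Metric.closedBall x r ∩ (H : Set (E n))) + (Hᗮ : Set (E n))

def RespectsCylinders {n : ℕ} (H : Submodule ℝ (E n)) (D : Body n → FinMeas n) : Prop :=
  ∀ (K : Body n) (x : E n) (r : ℝ), 0 < r →
    EssSubset K.set (cylinder H x r) → EssSubset (D K).1 (cylinder H x r)

def MapsBallsToBalls {n : ℕ} (D : Body n → FinMeas n) : Prop :=
  ∀ (x : E n) (r : ℝ) (hr : 0 < r), ∃ (x' : E n) (r' : ℝ) (hr' : 0 < r'),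
    EssEq (D (ball x r hr)).1 (ball x' r' hr').set

/-- `ψ` is a contraction with `D B(x + tu, r) = B(x + ψ(t)u, r)`, essentially, for all
`x ∈ u^⊥`, `t ∈ ℝ` and `r > 0`. -/
def IsBallShift {n : ℕ} (u : E n) (D : Body n → FinMeas n) (ψ : ℝ → ℝ) : Prop :=
  LipschitzWith 1 ψ ∧ ∀ x ∈ hyp u, ∀ (t r : ℝ) (hr : 0 < r),
    EssEq (D (ball (x + t • u) r hr)).1 (ball (x + ψ t • u) r hr).set

open Classical in
/-- The contraction `φ_D` associated with `D`: the function `ψ` with `IsBallShift u D ψ`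
(at most one exists when `u ≠ 0`; the value `0` is used if there is none). -/
def ballShift {n : ℕ} (u : E n) (D : Body n → FinMeas n) : ℝ → ℝ :=
  if h : ∃ ψ : ℝ → ℝ, IsBallShift u D ψ then h.choose else 0

/-- `K_t = (K - tu) ∩ (K† + tu)`, where `K†` is the reflection of `K` in `u^⊥`. -/
def symPart {n : ℕ} (u : E n) (K : Set (E n)) (t : ℝ) : Set (E n) :=
  translate K (-(t • u)) ∩ translate ((hyp u).reflection '' K) (t • u)

/-- The line `H^⊥ + x`. -/
def perpLine {n : ℕ} (H : Submodule ℝ (E n)) (x : E n) : Set (E n) :=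
  translate (Hᗮ : Set (E n)) x

/-- The height `t_x` for which `x + t_x u` is the midpoint of the chord of `K` on the line
through `x` in direction `u` (the value is irrelevant where the chord is empty). -/
def midHeight {n : ℕ} (u : E n) (K : Set (E n)) (x : E n) : ℝ :=
  (sInf {s : ℝ | x + s • u ∈ K} + sSup {s : ℝ | x + s • u ∈ K}) / 2

end ChordMovement

end

noncomputable section

namespace ChordMovement

variable {n : ℕ} {u : E n}

/-! Write points as `x + s u` with `x` in `H = u^⊥`. Over `x`, let the open chord of `int K` have
midpoint `m` and half-length `ℓ`. The set `int (K_t + φ(t)u)` contributes the interval about `φ(t)`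
of half-length `ℓ - |t - m|`. Since `|φ(t) - φ(m)| ≤ |t - m|`, each of these lies in the one for `t
= m`, so the union moves the chord rigidly by `φ(m) - m` (`chord_moved_of_interior_eq`). Fubini then
gives (ii) ⇔ (iii), and also that the union has the measure of `K`.

For (i) ⇒ (ii), measure fixes the radius of the image of a ball and cylinders fix its foot in `H`.
Comparing internally tangent balls shows that the new height depends only on the old one, through a
contraction (`exists_isBallShift`). A thin drum of radius `ρ` and half-height `a` fits in a ball of
radius `a + ρ²/(2a)`, so its image almost fills a drum about height `φ(t)`, missing only
`O(ρ^(n+1))` in measure. Such drums inside `K` show that the complement of `D K` has density zero at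
every point of the union (`volume_closedBall_diff_le`). Lebesgue density gives one inclusion and
equality of measures the other.

For (ii) ⇒ (i), the union is visibly monotone and stays over the projection of `K`, and it sends
balls to balls by comparison of volumes. -/

lemma haus_eq_volume (n : ℕ) : (haus n : Measure (E n)) = volume :=
  EuclideanSpace.euclideanHausdorffMeasure_eq_volume n

lemma haus_one_eq_volume : (haus 1 : Measure ℝ) = volume := by
  have h := InnerProductSpace.euclideanHausdorffMeasure_eq_volume (V := ℝ)
  rwa [Module.finrank_self] at h

lemma finrank_hyp (hu : ‖u‖ = 1) : Module.finrank ℝ (hyp u) + 1 = n := by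
  have h := Submodule.finrank_add_finrank_orthogonal (Submodule.span ℝ {u})
  rw [finrank_span_singleton (by rintro rfl; simp at hu), finrank_euclideanSpace_fin] at h
  change 1 + Module.finrank ℝ (hyp u) = n at h
  omega

lemma haus_hyp_eq_volume (hu : ‖u‖ = 1) : (haus (n - 1) : Measure (hyp u)) = volume := by
  have h := finrank_hyp hu
  rw [show n - 1 = Module.finrank ℝ (hyp u) by omega]
  exact InnerProductSpace.euclideanHausdorffMeasure_eq_volume

/-! ### Orthogonal coordinates along `u` -/

lemma mem_hyp_iff {x : E n} : x ∈ hyp u ↔ inner ℝ u x = 0 :=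
  Submodule.mem_orthogonal_singleton_iff_inner_right

lemma mem_hyp_orthogonal_iff {x : E n} : x ∈ (hyp u)ᗮ ↔ ∃ s : ℝ, s • u = x := by
  rw [Submodule.orthogonal_orthogonal, Submodule.mem_span_singleton]

lemma inner_hyp (x : hyp u) : inner ℝ u (x : E n) = 0 := mem_hyp_iff.1 x.2

lemma inner_self_one (hu : ‖u‖ = 1) : inner ℝ u u = 1 := by
  rw [real_inner_self_eq_norm_sq, hu]; norm_num

/-- The orthogonal projection onto the hyperplane `u^⊥`. -/
def foot (hu : ‖u‖ = 1) (y : E n) : hyp u :=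
  ⟨y - (inner ℝ u y : ℝ) • u, by
    rw [mem_hyp_iff, inner_sub_right, inner_smul_right, inner_self_one hu]; ring⟩

lemma coe_foot (hu : ‖u‖ = 1) (y : E n) : (foot hu y : E n) = y - (inner ℝ u y : ℝ) • u := rfl

lemma foot_add_smul (hu : ‖u‖ = 1) (x : hyp u) (s : ℝ) : foot hu ((x : E n) + s • u) = x := by
  ext1
  rw [coe_foot, inner_add_right, inner_smul_right, inner_hyp, inner_self_one hu]
  simp

lemma inner_add_smul (hu : ‖u‖ = 1) (x : hyp u) (s : ℝ) :
    (inner ℝ u ((x : E n) + s • u) : ℝ) = s := by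
  rw [inner_add_right, inner_smul_right, inner_hyp, inner_self_one hu]; ring

lemma foot_add_inner (hu : ‖u‖ = 1) (y : E n) :
    (foot hu y : E n) + (inner ℝ u y : ℝ) • u = y := by
  rw [coe_foot]; abel

lemma exists_eq_add_smul (hu : ‖u‖ = 1) (y : E n) : ∃ (x : hyp u) (s : ℝ), y = (x : E n) + s • u :=
  ⟨foot hu y, inner ℝ u y, (foot_add_inner hu y).symm⟩

lemma norm_sq_add_smul (hu : ‖u‖ = 1) (x : hyp u) (s : ℝ) :
    ‖(x : E n) + s • u‖ ^ 2 = ‖x‖ ^ 2 + s ^ 2 := by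
  rw [norm_add_sq_real, inner_smul_right, real_inner_comm, inner_hyp, norm_smul, hu]
  simp

lemma dist_sq_add_smul (hu : ‖u‖ = 1) (x y : hyp u) (s t : ℝ) :
    dist ((x : E n) + s • u) ((y : E n) + t • u) ^ 2 = dist x y ^ 2 + (s - t) ^ 2 := by
  rw [dist_eq_norm, dist_eq_norm, ← norm_sq_add_smul hu]
  congr 2
  push_cast
  rw [sub_smul]; abel

lemma add_smul_mem_closedBall (hu : ‖u‖ = 1) {x y : hyp u} {s t r : ℝ} (hr : 0 ≤ r) :
    (x : E n) + s • u ∈ Metric.closedBall ((y : E n) + t • u) r ↔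
      dist x y ^ 2 + (s - t) ^ 2 ≤ r ^ 2 := by
  rw [Metric.mem_closedBall, ← dist_sq_add_smul hu, sq_le_sq₀ dist_nonneg hr]

lemma add_smul_mem_ball (hu : ‖u‖ = 1) {x y : hyp u} {s t r : ℝ} (hr : 0 ≤ r) :
    (x : E n) + s • u ∈ Metric.ball ((y : E n) + t • u) r ↔
      dist x y ^ 2 + (s - t) ^ 2 < r ^ 2 := by
  rw [Metric.mem_ball, ← dist_sq_add_smul hu, sq_lt_sq₀ dist_nonneg hr]

/-- The orthogonal decomposition of `ℝ^n` into the hyperplane `u^⊥` and the axis spanned by `u`. -/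
def axisEquiv (hu : ‖u‖ = 1) : WithLp 2 (hyp u × ℝ) ≃ₗᵢ[ℝ] E n where
  toFun p := (p.fst : E n) + p.snd • u
  invFun y := WithLp.toLp 2 (foot hu y, inner ℝ u y)
  map_add' p q := by
    simp only [WithLp.add_fst, WithLp.add_snd, Submodule.coe_add, add_smul]; abel
  map_smul' c p := by
    simp [smul_add, mul_smul]
  left_inv p := by
    simp only [foot_add_smul, inner_add_smul hu]
    rfl
  right_inv y := by simp [foot_add_inner]
  norm_map' p := by
    rw [← sq_eq_sq₀ (norm_nonneg _) (norm_nonneg _), WithLp.prod_norm_sq_eq_of_L2]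
    simpa using norm_sq_add_smul hu p.fst p.snd

/-- The homeomorphism `(x, s) ↦ x + s u` from `u^⊥ × ℝ` to `ℝ^n`. -/
def axisHomeomorph (hu : ‖u‖ = 1) : (hyp u × ℝ) ≃ₜ E n :=
  (WithLp.homeomorphProd 2 (hyp u) ℝ).symm.trans (axisEquiv hu).toHomeomorph

@[simp] lemma axisHomeomorph_apply (hu : ‖u‖ = 1) (p : hyp u × ℝ) :
    axisHomeomorph hu p = (p.1 : E n) + p.2 • u := rfl

lemma measurePreserving_axisHomeomorph (hu : ‖u‖ = 1) :
    MeasurePreserving (axisHomeomorph hu) (volume.prod volume) volume :=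
  (axisEquiv hu).measurePreserving.comp (WithLp.volume_preserving_toLp (hyp u) ℝ)

lemma continuous_foot (hu : ‖u‖ = 1) : Continuous (foot hu) := by
  have : foot hu = fun y => ((axisHomeomorph hu).symm y).1 := by
    ext1 y
    obtain ⟨p, rfl⟩ := (axisHomeomorph hu).surjective y
    rw [Homeomorph.symm_apply_apply, axisHomeomorph_apply, foot_add_smul]
  rw [this]; fun_prop

/-! ### Chords and Fubini -/

/-- The set of heights at which the line through `x` in direction `u` meets `A`. -/
def chord (u : E n) (A : Set (E n)) (x : hyp u) : Set ℝ := {s | (x : E n) + s • u ∈ A}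

@[simp] lemma mem_chord {A : Set (E n)} {x : hyp u} {s : ℝ} :
    s ∈ chord u A x ↔ (x : E n) + s • u ∈ A := Iff.rfl

lemma continuous_line (u : E n) (x : hyp u) : Continuous fun s : ℝ => (x : E n) + s • u := by
  fun_prop

lemma isometry_line (hu : ‖u‖ = 1) (x : hyp u) : Isometry fun s : ℝ => (x : E n) + s • u := by
  refine Isometry.of_dist_eq fun s t => ?_
  rw [dist_add_left, dist_eq_norm, ← sub_smul, norm_smul, hu, mul_one, Real.dist_eq,
    Real.norm_eq_abs]

lemma volume_eq_lintegral_chord (hu : ‖u‖ = 1) {A : Set (E n)} (hA : MeasurableSet A) :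
    volume A = ∫⁻ x : hyp u, volume (chord u A x) := by
  rw [← (measurePreserving_axisHomeomorph hu).measure_preimage hA.nullMeasurableSet,
    Measure.prod_apply ((axisHomeomorph hu).continuous.measurable hA)]
  rfl

lemma volume_eq_zero_iff_chord (hu : ‖u‖ = 1) {A : Set (E n)}
    (hA : NullMeasurableSet A volume) :
    volume A = 0 ↔ ∀ᵐ x : hyp u, volume (chord u A x) = 0 := by
  have key : ∀ B : Set (E n), volume B = 0 → ∀ᵐ x : hyp u, volume (chord u B x) = 0 := by
    intro B hB
    have h := (measurePreserving_axisHomeomorph hu).quasiMeasurePreserving.preimage_null hB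
    exact Measure.measure_ae_null_of_prod_null h
  refine ⟨key A, fun h => ?_⟩
  -- Fubini needs a Borel set. A subset of `A` is chosen so that its chords are still null.
  obtain ⟨B, hBA, hB, hAB⟩ := hA.exists_measurable_subset_ae_eq
  rw [← measure_congr hAB, volume_eq_lintegral_chord hu hB]
  refine lintegral_eq_zero_of_ae_eq_zero ?_
  filter_upwards [h] with x hx
  exact measure_mono_null (fun s hs => hBA hs) hx

/-- Two measurable sets agree essentially iff almost all their chords do. -/
lemma ae_eq_iff_chord (hu : ‖u‖ = 1) {A B : Set (E n)}
    (hA : NullMeasurableSet A volume) (hB : NullMeasurableSet B volume) :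
    A =ᵐ[volume] B ↔ ∀ᵐ x : hyp u, chord u A x =ᵐ[volume] chord u B x := by
  simp only [← measure_symmDiff_eq_zero_iff]
  rw [volume_eq_zero_iff_chord hu (hA.symmDiff hB)]
  rfl

lemma inter_perpLine (A : Set (E n)) (x : hyp u) :
    A ∩ perpLine (hyp u) x = (fun s : ℝ => (x : E n) + s • u) '' chord u A x := by
  ext y
  simp only [perpLine, translate, mem_inter_iff, mem_image, SetLike.mem_coe, mem_chord,
    mem_hyp_orthogonal_iff]
  constructor
  · rintro ⟨hy, z, ⟨s, rfl⟩, rfl⟩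
    exact ⟨s, by rwa [add_comm], add_comm _ _⟩
  · rintro ⟨s, hs, rfl⟩
    exact ⟨hs, s • u, ⟨s, rfl⟩, add_comm _ _⟩

lemma translate_line_image (S : Set ℝ) (x : hyp u) (c : ℝ) :
    translate ((fun s : ℝ => (x : E n) + s • u) '' S) (c • u) =
      (fun s : ℝ => (x : E n) + s • u) '' ((· + c) '' S) := by
  simp only [translate, image_image, add_smul, add_assoc]

lemma line_image_ae_eq_iff (hu : ‖u‖ = 1) (x : hyp u) {S T : Set ℝ} :
    ((fun s : ℝ => (x : E n) + s • u) '' S : Set (E n)) =ᵐ[haus 1]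
      ((fun s : ℝ => (x : E n) + s • u) '' T : Set (E n)) ↔ S =ᵐ[volume] T := by
  have hi := isometry_line hu x
  rw [← measure_symmDiff_eq_zero_iff, ← measure_symmDiff_eq_zero_iff,
    ← image_symmDiff hi.injective, hi.euclideanHausdorffMeasure_image,
    show Measure.euclideanHausdorffMeasure 1 = volume from haus_one_eq_volume]

/-! ### Essential inclusion and convex bodies -/

lemma essSubset_iff {A B : Set (E n)} : EssSubset A B ↔ A ≤ᵐ[volume] B := by
  rw [EssSubset, haus_eq_volume]

lemma essEq_iff {A B : Set (E n)} : EssEq A B ↔ A =ᵐ[volume] B := by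
  rw [EssEq, haus_eq_volume]

lemma FinMeas.nullMeasurableSet (A : FinMeas n) : NullMeasurableSet A.1 volume :=
  haus_eq_volume n ▸ A.2.1

lemma FinMeas.volume_lt_top (A : FinMeas n) : volume A.1 < ⊤ :=
  haus_eq_volume n ▸ A.2.2

lemma Body.convex (K : Body n) : Convex ℝ K.set := K.1.convex

lemma Body.isCompact (K : Body n) : IsCompact K.set := K.1.isCompact

lemma Body.isClosed (K : Body n) : IsClosed K.set := K.isCompact.isClosed

lemma Body.interior_nonempty (K : Body n) : (interior K.set).Nonempty := K.2

lemma Body.closure_interior (K : Body n) : closure (interior K.set) = K.set := by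
  rw [K.convex.closure_interior_eq_closure_of_nonempty_interior K.interior_nonempty,
    K.isClosed.closure_eq]

lemma Body.interior_ae_eq (K : Body n) : interior K.set =ᵐ[volume] K.set :=
  interior_ae_eq_of_null_frontier (K.convex.addHaar_frontier volume)

/-- A convex body that is essentially contained in a closed set is contained in it. -/
lemma Body.subset_of_essSubset {K : Body n} {F : Set (E n)} (hF : IsClosed F)
    (h : EssSubset K.set F) : K.set ⊆ F := by
  rw [essSubset_iff, ae_le_set] at h
  -- An open null set is empty.
  have h0 : interior K.set \ F = ∅ :=
    ((isOpen_interior.sdiff hF).measure_eq_zero_iff volume).1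
      (measure_mono_null (sdiff_subset_sdiff_left interior_subset) h)
  rw [← K.closure_interior]
  exact closure_minimal (sdiff_eq_empty.1 h0) hF

lemma ball_set (x : E n) (r : ℝ) (hr : 0 < r) : (ball x r hr).set = Metric.closedBall x r := rfl

lemma interior_translate (A : Set (E n)) (v : E n) :
    interior (translate A v) = translate (interior A) v :=
  ((Homeomorph.addRight v).image_interior A).symm

lemma mem_translate {A : Set (E n)} {v y : E n} : y ∈ translate A v ↔ y - v ∈ A := by
  simp [translate, sub_eq_add_neg]

lemma reflection_add_smul (x : hyp u) (s : ℝ) :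
    (hyp u).reflection ((x : E n) + s • u) = (x : E n) + (-s) • u := by
  rw [map_add, Submodule.reflection_mem_subspace_eq_self x.2,
    Submodule.reflection_mem_subspace_orthogonalComplement_eq_neg
      (mem_hyp_orthogonal_iff.2 ⟨s, rfl⟩), neg_smul]

/-! ### The moved set and its chords -/

/-- The union of the open sets `int (K_t + φ(t) u)`. -/
def moved (u : E n) (φ : ℝ → ℝ) (K : Set (E n)) : Set (E n) :=
  ⋃ t : ℝ, interior (translate (symPart u K t) (φ t • u))

lemma isOpen_moved (u : E n) (φ : ℝ → ℝ) (K : Set (E n)) : IsOpen (moved u φ K) :=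
  isOpen_iUnion fun _ => isOpen_interior

/-- Interior commutes with translation, reflection and finite intersection, and reflection negates
heights; so the two conditions are those of `K - tu` and `K† + tu`. -/
lemma add_smul_mem_moved {φ : ℝ → ℝ} {K : Set (E n)} {x : hyp u} {s : ℝ} :
    (x : E n) + s • u ∈ moved u φ K ↔
      ∃ t, t + (s - φ t) ∈ chord u (interior K) x ∧ t - (s - φ t) ∈ chord u (interior K) x := by
  have hr : interior ((hyp u).reflection '' K) = (hyp u).reflection '' interior K :=
    ((hyp u).reflection.toHomeomorph.image_interior K).symm
  simp only [moved, mem_iUnion, interior_translate, symPart, interior_inter, mem_translate,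
    mem_inter_iff, hr, mem_chord]
  refine exists_congr fun t => and_congr ?_ ?_
  · rw [show (x : E n) + s • u - φ t • u - -(t • u) = (x : E n) + (t + (s - φ t)) • u by module]
  · rw [show (x : E n) + s • u - φ t • u - t • u = (x : E n) + (-(t - (s - φ t))) • u by module,
      ← reflection_add_smul, (hyp u).reflection.injective.mem_set_image]

lemma moved_mono {φ : ℝ → ℝ} {K L : Set (E n)} (h : K ⊆ L) : moved u φ K ⊆ moved u φ L :=
  iUnion_mono fun _ => interior_mono <| image_mono <|
    inter_subset_inter (image_mono h) (image_mono (image_mono h))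

lemma isCompact_chord (hu : ‖u‖ = 1) {K : Set (E n)} (hK : IsCompact K) (x : hyp u) :
    IsCompact (chord u K x) :=
  (isometry_line hu x).isClosedEmbedding.isCompact_preimage hK

/-- A chord through the interior of a convex body is a nondegenerate interval, whose interior
consists of interior points of the body. -/
lemma exists_chord_eq (hu : ‖u‖ = 1) (K : Body n) {x : hyp u}
    (hx : (chord u (interior K.set) x).Nonempty) :
    ∃ a b : ℝ, a < b ∧ chord u K.set x = Icc a b ∧ chord u (interior K.set) x = Ioo a b := by
  have hc : IsCompact (chord u K.set x) := isCompact_chord hu K.isCompact x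
  have hsub : chord u (interior K.set) x ⊆ chord u K.set x :=
    fun s hs => interior_subset (s := K.set) hs
  have hne := hx.mono hsub
  have hconv : Convex ℝ (chord u K.set x) := by
    intro s hs t ht a b ha hb hab
    have := K.convex hs ht ha hb hab
    rw [mem_chord]
    convert this using 1
    obtain rfl : a = 1 - b := by linarith
    rw [smul_eq_mul, smul_eq_mul]
    module
  have hIcc : chord u K.set x = Icc (sInf (chord u K.set x)) (sSup (chord u K.set x)) :=
    eq_Icc_of_connected_compact ⟨hne, hconv.ordConnected.isPreconnected⟩ hc
  set a := sInf (chord u K.set x)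
  set b := sSup (chord u K.set x)
  have hopen : IsOpen (chord u (interior K.set) x) :=
    isOpen_interior.preimage (continuous_line u x)
  have hsub' : chord u (interior K.set) x ⊆ Ioo a b := by
    rw [← interior_Icc, ← hIcc]
    exact hopen.subset_interior_iff.2 hsub
  obtain ⟨s₀, hs₀⟩ := hx
  have h₀ := hsub' hs₀
  have hab : a < b := h₀.1.trans h₀.2
  -- Points strictly between an interior point and a point of `K` are interior; `c = a` and `c = b`
  -- cover the two halves of the chord.
  have key : ∀ c ∈ Icc a b, ∀ θ ∈ Ioo (0 : ℝ) 1,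
      (1 - θ) * s₀ + θ * c ∈ chord u (interior K.set) x := by
    intro c hc θ hθ
    rw [← hIcc] at hc
    have := K.convex.combo_interior_self_mem_interior hs₀ hc (a := 1 - θ) (b := θ)
      (by linarith [hθ.2]) hθ.1.le (by ring)
    rw [mem_chord]
    convert this using 1
    module
  refine ⟨a, b, hab, hIcc, hsub'.antisymm fun s hs => ?_⟩
  rcases lt_trichotomy s s₀ with h | rfl | h
  · have := key a (left_mem_Icc.2 hab.le) ((s₀ - s) / (s₀ - a))
      ⟨div_pos (by linarith) (by linarith [h₀.1]),
        (div_lt_one (by linarith [h₀.1])).2 (by linarith [hs.1])⟩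
    convert this using 1
    field_simp [(sub_pos.2 h₀.1).ne']
    ring
  · exact hs₀
  · have := key b (right_mem_Icc.2 hab.le) ((s - s₀) / (b - s₀))
      ⟨div_pos (by linarith) (by linarith [h₀.2]),
        (div_lt_one (by linarith [h₀.2])).2 (by linarith [hs.2])⟩
    convert this using 1
    field_simp [(sub_pos.2 h₀.2).ne']
    ring

/-- This is where the contraction property enters: moving `t` away from the midpoint shortens the
symmetric interval by at least as much as `φ` shifts its center. The parameter `t = (a + b) / 2`
alone gives everything. -/
lemma chord_moved_of_interior_eq {φ : ℝ → ℝ} (hφ : LipschitzWith 1 φ)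
    {K : Set (E n)} {x : hyp u} {a b : ℝ}
    (hI : chord u (interior K) x = Ioo a b) :
    chord u (moved u φ K) x =
      Ioo (a + (φ ((a + b) / 2) - (a + b) / 2)) (b + (φ ((a + b) / 2) - (a + b) / 2)) := by
  ext s
  rw [mem_chord, add_smul_mem_moved, hI]
  constructor
  · rintro ⟨t, h1, h2⟩
    have h := hφ.dist_le_mul t ((a + b) / 2)
    rw [NNReal.coe_one, one_mul, Real.dist_eq, Real.dist_eq] at h
    obtain ⟨h3, h4⟩ := abs_le.1 h
    rcases abs_cases (t - (a + b) / 2) with ⟨h5, _⟩ | ⟨h5, _⟩ <;> rw [h5] at h3 h4 <;>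
      constructor <;> linarith [h1.1, h1.2, h2.1, h2.2]
  · intro hs
    exact ⟨(a + b) / 2, ⟨by linarith [hs.1], by linarith [hs.2]⟩,
      ⟨by linarith [hs.2], by linarith [hs.1]⟩⟩

lemma ae_chord_moved (hu : ‖u‖ = 1) {φ : ℝ → ℝ} (hφ : LipschitzWith 1 φ) (K : Body n) :
    ∀ᵐ x : hyp u, chord u (moved u φ K.set) x =ᵐ[volume]
      ((· + (φ (midHeight u K.set x) - midHeight u K.set x)) '' chord u K.set x : Set ℝ) := by
  have h := (ae_eq_iff_chord hu isOpen_interior.measurableSet.nullMeasurableSet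
    K.isClosed.measurableSet.nullMeasurableSet).1 K.interior_ae_eq
  filter_upwards [h] with x hx
  -- Lines that miss the interior may meet `K` in a boundary segment, but for almost every `x` that
  -- segment is null.
  rcases (chord u (interior K.set) x).eq_empty_or_nonempty with h0 | h0
  · have h1 : chord u (moved u φ K.set) x = ∅ := by
      refine eq_empty_of_forall_notMem fun s hs => ?_
      obtain ⟨t, ht, -⟩ := add_smul_mem_moved.1 hs
      rw [h0] at ht
      exact ht
    rw [h0] at hx
    rw [h1]
    refine Filter.EventuallyEq.symm (ae_eq_empty.2 ?_)
    rw [image_add_right, measure_preimage_add_right]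
    exact ae_eq_empty.1 hx.symm
  · obtain ⟨a, b, hab, hK, hI⟩ := exists_chord_eq hu K h0
    have hm : midHeight u K.set x = (a + b) / 2 := by
      change (sInf (chord u K.set x) + sSup (chord u K.set x)) / 2 = _
      rw [hK, csInf_Icc hab.le, csSup_Icc hab.le]
    rw [hm, chord_moved_of_interior_eq hφ hI, hK, image_add_const_Icc]
    exact Ioo_ae_eq_Icc

lemma volume_moved (hu : ‖u‖ = 1) {φ : ℝ → ℝ} (hφ : LipschitzWith 1 φ) (K : Body n) :
    volume (moved u φ K.set) = volume K.set := by
  rw [volume_eq_lintegral_chord hu (isOpen_moved u φ K.set).measurableSet,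
    volume_eq_lintegral_chord hu K.isClosed.measurableSet]
  refine lintegral_congr_ae ?_
  filter_upwards [ae_chord_moved hu hφ K] with x hx
  rw [measure_congr hx, image_add_right, measure_preimage_add_right]

/-- A set agrees essentially with the union of the sets `int (K_t + φ(t) u)` iff almost all of its
chords are the translated chords of `K`. -/
lemma essEq_moved_iff (hu : ‖u‖ = 1) {φ : ℝ → ℝ} (hφ : LipschitzWith 1 φ) (K : Body n)
    {A : Set (E n)} (hA : NullMeasurableSet A volume) :
    EssEq A (moved u φ K.set) ↔
      ∀ᵐ x : hyp u ∂(haus (n - 1)),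
        (A ∩ perpLine (hyp u) (x : E n) : Set (E n)) =ᵐ[haus 1]
          (translate (K.set ∩ perpLine (hyp u) (x : E n))
            ((φ (midHeight u K.set x) - midHeight u K.set x) • u) : Set (E n)) := by
  rw [essEq_iff, haus_hyp_eq_volume hu,
    ae_eq_iff_chord hu hA (isOpen_moved u φ K.set).measurableSet.nullMeasurableSet]
  refine Filter.eventually_congr ?_
  filter_upwards [ae_chord_moved hu hφ K] with x hx
  rw [inter_perpLine, inter_perpLine, translate_line_image, line_image_ae_eq_iff hu]
  exact ⟨fun h => h.trans hx, fun h => h.trans hx.symm⟩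

/-! ### Cylinders and inclusions of balls -/

lemma mem_cylinder_iff (hu : ‖u‖ = 1) {c y : E n} {r : ℝ} :
    y ∈ cylinder (hyp u) c r ↔ (foot hu y : E n) ∈ Metric.closedBall c r := by
  rw [cylinder, mem_add]
  constructor
  · rintro ⟨p, ⟨hp, hpH⟩, q, hq, rfl⟩
    obtain ⟨s, rfl⟩ := mem_hyp_orthogonal_iff.1 hq
    rwa [foot_add_smul hu ⟨p, hpH⟩ s]
  · intro h
    exact ⟨foot hu y, ⟨h, (foot hu y).2⟩, (inner ℝ u y : ℝ) • u,
      mem_hyp_orthogonal_iff.2 ⟨_, rfl⟩, foot_add_inner hu y⟩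

lemma isClosed_cylinder (hu : ‖u‖ = 1) (c : E n) (r : ℝ) : IsClosed (cylinder (hyp u) c r) := by
  have : cylinder (hyp u) c r = (fun y => (foot hu y : E n)) ⁻¹' Metric.closedBall c r := by
    ext y; exact mem_cylinder_iff hu
  rw [this]
  exact Metric.isClosed_closedBall.preimage (continuous_subtype_val.comp (continuous_foot hu))

lemma add_smul_mem_cylinder (hu : ‖u‖ = 1) {x y : hyp u} {s r : ℝ} :
    (x : E n) + s • u ∈ cylinder (hyp u) (y : E n) r ↔ dist x y ≤ r := by
  rw [mem_cylinder_iff hu, foot_add_smul]; rfl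

lemma nontrivial_hyp (hn : 2 ≤ n) (hu : ‖u‖ = 1) : Nontrivial (hyp u) := by
  have h := finrank_hyp hu
  exact Module.nontrivial_of_finrank_pos (R := ℝ) (by omega)

lemma exists_unit_mem_hyp (hn : 2 ≤ n) (hu : ‖u‖ = 1) : ∃ e : hyp u, ‖e‖ = 1 := by
  have := nontrivial_hyp hn hu
  exact exists_norm_eq (hyp u) zero_le_one

/-- Inclusion of closed balls in a normed space is controlled by the distance of the centers. -/
lemma dist_le_of_closedBall_subset {V : Type*} [NormedAddCommGroup V] [NormedSpace ℝ V]
    [Nontrivial V] {p q : V} {r s : ℝ} (hr : 0 ≤ r)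
    (h : Metric.closedBall p r ⊆ Metric.closedBall q s) : dist p q ≤ s - r := by
  rcases eq_or_ne p q with rfl | hpq
  · obtain ⟨e, he⟩ := exists_norm_eq V hr
    have := h (show p + e ∈ Metric.closedBall p r by simp [he])
    simp [he] at this
    simpa using this
  · have hd : 0 < ‖p - q‖ := norm_pos_iff.2 (sub_ne_zero.2 hpq)
    -- The point of the first ball farthest from `q`.
    have := h (show p + (r / ‖p - q‖) • (p - q) ∈ Metric.closedBall p r by
      simp [norm_smul, abs_of_nonneg hr, hd.ne'])
    rw [Metric.mem_closedBall, dist_eq_norm,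
      show p + (r / ‖p - q‖) • (p - q) - q = (1 + r / ‖p - q‖) • (p - q) by module,
      norm_smul, Real.norm_of_nonneg (by positivity)] at this
    rw [dist_eq_norm]
    have h2 : (1 + r / ‖p - q‖) * ‖p - q‖ = ‖p - q‖ + r := by field_simp
    linarith

lemma nontrivial_of_two_le (hn : 2 ≤ n) : Nontrivial (E n) :=
  Module.nontrivial_of_finrank_pos (R := ℝ) (by rw [finrank_euclideanSpace_fin]; omega)

lemma dist_le_of_essSubset_closedBall (hn : 2 ≤ n) {p q : E n} {r s : ℝ} (hr : 0 < r)
    (h : EssSubset (Metric.closedBall p r) (Metric.closedBall q s)) : dist p q ≤ s - r := by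
  have := nontrivial_of_two_le hn
  exact dist_le_of_closedBall_subset hr.le
    (Body.subset_of_essSubset (K := ball p r hr) Metric.isClosed_closedBall h)

lemma closedBall_volume_injective (hn : 2 ≤ n) {p q : E n} {r s : ℝ} (hr : 0 < r) (hs : 0 < s)
    (h : volume (Metric.closedBall p r) = volume (Metric.closedBall q s)) : r = s := by
  rw [Measure.addHaar_closedBall _ _ hr.le, Measure.addHaar_closedBall _ _ hs.le,
    ENNReal.mul_left_inj (Metric.measure_ball_pos _ _ one_pos).ne' measure_ball_lt_top.ne,
    ENNReal.ofReal_eq_ofReal_iff (by positivity) (by positivity)] at h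
  refine (pow_left_inj₀ hr.le hs.le ?_).1 h
  rw [finrank_euclideanSpace_fin]; omega

/-! ### The contraction determined by the images of balls -/

section BallShift

variable {D : Body n → FinMeas n}

/-- Measure preservation forces the same radius. The cylinder circumscribed about the ball contains
the image, and a ball of radius `r` in a cylinder of radius `r` has its center on the axis. -/
lemma exists_ball_image (hn : 2 ≤ n) (hu : ‖u‖ = 1) (hmeas : MeasPreserving D)
    (hcyl : RespectsCylinders (hyp u) D) (hball : MapsBallsToBalls D) (x : hyp u) (t r : ℝ)
    (hr : 0 < r) :
    ∃ s : ℝ, EssEq (D (ball ((x : E n) + t • u) r hr)).1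
      (Metric.closedBall ((x : E n) + s • u) r) := by
  have := nontrivial_hyp hn hu
  obtain ⟨x', r', hr', h⟩ := hball ((x : E n) + t • u) r hr
  rw [ball_set] at h
  obtain rfl : r = r' := by
    refine closedBall_volume_injective hn hr hr' (p := (x : E n) + t • u) (q := x') ?_
    have h1 := hmeas (ball ((x : E n) + t • u) r hr)
    rw [measure_congr h, ball_set, haus_eq_volume] at h1
    exact h1.symm
  obtain ⟨y, s, rfl⟩ := exists_eq_add_smul hu x'
  have h1 : EssSubset (ball ((x : E n) + t • u) r hr).set (cylinder (hyp u) (x : E n) r) := by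
    refine Filter.Eventually.of_forall fun z hz => ?_
    obtain ⟨z, c, rfl⟩ := exists_eq_add_smul hu z
    have hz' := (add_smul_mem_closedBall hu hr.le).1 hz
    refine (add_smul_mem_cylinder hu).2 ?_
    exact abs_le_of_sq_le_sq' (by nlinarith [sq_nonneg (c - t)]) hr.le |>.2
  have h2 : EssSubset (Metric.closedBall ((y : E n) + s • u) r)
      (cylinder (hyp u) (x : E n) r) :=
    h.symm.le.trans (hcyl _ _ _ hr h1)
  have h3 := Body.subset_of_essSubset (K := ball ((y : E n) + s • u) r hr)
    (isClosed_cylinder hu _ _) h2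
  have h4 : Metric.closedBall y r ⊆ Metric.closedBall x r := by
    intro z hz
    refine (add_smul_mem_cylinder hu (s := s)).1 (h3 ?_)
    refine (add_smul_mem_closedBall hu hr.le).2 ?_
    rw [sub_self]
    have : dist z y ^ 2 ≤ r ^ 2 := pow_le_pow_left₀ dist_nonneg hz 2
    simpa using this
  have h5 := dist_le_of_closedBall_subset hr.le h4
  obtain rfl : y = x := dist_le_zero.1 (by linarith)
  exact ⟨s, h⟩

/-- A monotonic, measure preserving map that respects cylinders and maps balls to balls moves
balls vertically, by an amount that depends only on the height of the center. -/
lemma exists_isBallShift (hn : 2 ≤ n) (hu : ‖u‖ = 1) (hmono : Monotonic D)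
    (hmeas : MeasPreserving D) (hcyl : RespectsCylinders (hyp u) D) (hball : MapsBallsToBalls D) :
    ∃ ψ, IsBallShift u D ψ := by
  -- Positivity of `r` is put after the witness so that the chosen height `f` does not depend on a
  -- proof; for `r ≤ 0` the value is a dummy.
  have hex : ∀ (x : hyp u) (t r : ℝ), ∃ s : ℝ, ∀ hr : 0 < r,
      EssEq (D (ball ((x : E n) + t • u) r hr)).1 (Metric.closedBall ((x : E n) + s • u) r) := by
    intro x t r
    by_cases hr : 0 < r
    · obtain ⟨s, hs⟩ := exists_ball_image hn hu hmeas hcyl hball x t r hr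
      exact ⟨s, fun _ => hs⟩
    · exact ⟨0, fun h => absurd h hr⟩
  choose f hf using hex
  have hdist : ∀ (x y : hyp u) (t t' r s : ℝ), 0 < s → s ≤ r →
      dist y x ^ 2 + (t' - t) ^ 2 ≤ (r - s) ^ 2 →
      dist y x ^ 2 + (f y t' s - f x t r) ^ 2 ≤ (r - s) ^ 2 := by
    intro x y t t' r s hs hsr h
    have hr := hs.trans_le hsr
    have hsub : (ball ((y : E n) + t' • u) s hs).set ⊆ (ball ((x : E n) + t • u) r hr).set := by
      refine Metric.closedBall_subset_closedBall' ?_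
      rw [← dist_sq_add_smul hu] at h
      linarith [(sq_le_sq₀ dist_nonneg (by linarith)).1 h]
    have h1 := hmono _ _ (Filter.Eventually.of_forall hsub)
    have h2 := dist_le_of_essSubset_closedBall hn hs
      ((hf y t' s hs).symm.le.trans (h1.trans (hf x t r hr).le))
    rw [← dist_sq_add_smul hu]
    exact pow_le_pow_left₀ dist_nonneg h2 2
  -- Internal tangency at equal heights leaves no room for a vertical displacement of the images.
  have heq : ∀ (x y : hyp u) (t r s : ℝ), 0 < s → dist y x = r - s → f y t s = f x t r := by
    intro x y t r s hs h
    have := hdist x y t t r s hs (by linarith [dist_nonneg (x := y) (y := x)])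
      (by rw [h, sub_self]; simp)
    rw [h] at this
    have h0 : (f y t s - f x t r) ^ 2 = 0 := le_antisymm (by linarith) (sq_nonneg _)
    linarith [pow_eq_zero_iff two_ne_zero |>.1 h0]
  -- Concentric balls are not tangent, so the comparison passes through a ball of radius `(r + s) /
  -- 2` shifted horizontally by `(r - s) / 2`. A horizontal direction exists because `n ≥ 2`.
  have hrad : ∀ (x : hyp u) (t r s : ℝ), 0 < s → s ≤ r → f x t s = f x t r := by
    intro x t r s hs hsr
    obtain ⟨e, he⟩ := exists_unit_mem_hyp hn hu
    have hd : ‖((r - s) / 2) • e‖ = (r - s) / 2 := by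
      rw [norm_smul, he, mul_one, Real.norm_of_nonneg (by linarith)]
    rw [heq (x + ((r - s) / 2) • e) x t ((r + s) / 2) s hs (by rw [dist_self_add_right, hd]; ring),
      heq x (x + ((r - s) / 2) • e) t r ((r + s) / 2) (by linarith)
        (by rw [dist_self_add_left, hd]; ring)]
  have hindep : ∀ (x : hyp u) (t r : ℝ), 0 < r → f x t r = f 0 t 1 := by
    intro x t r hr
    have hd := dist_nonneg (x := x) (y := (0 : hyp u))
    rw [heq 0 x t (r + dist x 0) r hr (by ring)]
    rcases le_total 1 (r + dist x 0) with h | h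
    · exact (hrad 0 t _ 1 one_pos h).symm
    · exact hrad 0 t _ _ (by linarith) h
  refine ⟨fun t => f 0 t 1, LipschitzWith.of_dist_le_mul fun t t' => ?_, fun x hx t r hr => ?_⟩
  -- Vertical tangency: the unit ball at height `t` lies in the ball of radius `1 + |t - t'|` at
  -- height `t'`.
  · have h := hdist 0 0 t' t (1 + |t - t'|) 1 one_pos (by linarith [abs_nonneg (t - t')]) (by simp)
    rw [hindep 0 t' _ (by positivity), dist_self, add_sub_cancel_left, sq_abs] at h
    rw [NNReal.coe_one, one_mul, Real.dist_eq, Real.dist_eq]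
    exact sq_le_sq.1 (by linarith)
  · have h := hf ⟨x, hx⟩ t r hr
    rwa [hindep _ t r hr] at h

lemma IsBallShift.unique (hn : 2 ≤ n) (hu : ‖u‖ = 1) {ψ φ : ℝ → ℝ} (h : IsBallShift u D ψ)
    (h' : IsBallShift u D φ) : ψ = φ := by
  ext t
  have h1 := (h.2 0 (zero_mem _) t 1 one_pos).symm.trans (h'.2 0 (zero_mem _) t 1 one_pos)
  have h2 := dist_le_of_essSubset_closedBall hn one_pos h1.le
  rw [sub_self, dist_le_zero, zero_add, zero_add] at h2
  have hu0 : u ≠ 0 := by rintro rfl; simp at hu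
  exact smul_left_injective ℝ hu0 h2

lemma IsBallShift.eq_ballShift (hn : 2 ≤ n) (hu : ‖u‖ = 1) {φ : ℝ → ℝ} (h : IsBallShift u D φ) :
    φ = ballShift u D := by
  have hex : ∃ ψ, IsBallShift u D ψ := ⟨φ, h⟩
  rw [ballShift, dif_pos hex]
  exact h.unique hn hu hex.choose_spec

lemma isBallShift_ballShift (hn : 2 ≤ n) (hu : ‖u‖ = 1) (hmono : Monotonic D)
    (hmeas : MeasPreserving D) (hcyl : RespectsCylinders (hyp u) D) (hball : MapsBallsToBalls D) :
    IsBallShift u D (ballShift u D) := by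
  obtain ⟨ψ, hψ⟩ := exists_isBallShift hn hu hmono hmeas hcyl hball
  rwa [← hψ.eq_ballShift hn hu]

end BallShift

/-! ### Thin drums -/

/-- The right circular cylinder of radius `ρ` about the axis through `x`, with heights in
`[c - a, c + a]`. -/
def drum (hu : ‖u‖ = 1) (x : hyp u) (ρ c a : ℝ) : Set (E n) :=
  axisHomeomorph hu '' (Metric.closedBall x ρ ×ˢ Metric.closedBall c a)

lemma add_smul_mem_drum (hu : ‖u‖ = 1) {x y : hyp u} {s ρ c a : ℝ} :
    (y : E n) + s • u ∈ drum hu x ρ c a ↔ dist y x ≤ ρ ∧ |s - c| ≤ a := by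
  rw [drum, ← axisHomeomorph_apply hu (y, s), (axisHomeomorph hu).injective.mem_set_image]
  rfl

lemma isCompact_drum (hu : ‖u‖ = 1) (x : hyp u) (ρ c a : ℝ) : IsCompact (drum hu x ρ c a) :=
  ((isCompact_closedBall x ρ).prod (isCompact_closedBall c a)).image (axisHomeomorph hu).continuous

lemma convex_drum (hu : ‖u‖ = 1) (x : hyp u) (ρ c a : ℝ) : Convex ℝ (drum hu x ρ c a) := by
  refine ((convex_closedBall x ρ).prod (convex_closedBall c a)).is_linear_image ⟨?_, ?_⟩
  · intro p q
    simp only [axisHomeomorph_apply, Prod.fst_add, Prod.snd_add, Submodule.coe_add]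
    module
  · intro b p
    simp [smul_add, mul_smul]

lemma volume_drum (hu : ‖u‖ = 1) (x : hyp u) (ρ c a : ℝ) :
    volume (drum hu x ρ c a) = volume (Metric.closedBall x ρ) * ENNReal.ofReal (2 * a) := by
  rw [← (measurePreserving_axisHomeomorph hu).measure_preimage
    (isCompact_drum hu x ρ c a).measurableSet.nullMeasurableSet, drum,
    (axisHomeomorph hu).injective.preimage_image, Measure.prod_prod, Real.volume_closedBall]

/-- The drum as a convex body. -/
def drumBody (hu : ‖u‖ = 1) (x : hyp u) (ρ c a : ℝ) (hρ : 0 < ρ) (ha : 0 < a) : Body n :=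
  ⟨{ carrier := drum hu x ρ c a
     convex' := convex_drum hu x ρ c a
     isCompact' := isCompact_drum hu x ρ c a
     nonempty' := ⟨_, (add_smul_mem_drum hu (y := x) (s := c)).2 (by simp [hρ.le, ha.le])⟩ },
   by
    change (interior (drum hu x ρ c a)).Nonempty
    rw [drum, ← (axisHomeomorph hu).image_interior, image_nonempty, interior_prod_eq]
    exact ⟨(x, c), Metric.ball_subset_interior_closedBall (Metric.mem_ball_self hρ),
      Metric.ball_subset_interior_closedBall (Metric.mem_ball_self ha)⟩⟩

lemma drumBody_set (hu : ‖u‖ = 1) (x : hyp u) (ρ c a : ℝ) (hρ : 0 < ρ) (ha : 0 < a) :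
    (drumBody hu x ρ c a hρ ha).set = drum hu x ρ c a := rfl

/-- A chord between two interior points of a convex body has a thin drum about it in the body. -/
lemma exists_drum_subset (hu : ‖u‖ = 1) (K : Body n) {x : hyp u} {t a : ℝ} (ha : 0 < a)
    (h₁ : t + a ∈ chord u (interior K.set) x) (h₂ : t - a ∈ chord u (interior K.set) x) :
    ∃ δ > 0, ∀ ρ ≤ δ, drum hu x ρ t a ⊆ K.set := by
  obtain ⟨δ₁, hδ₁, hb₁⟩ := Metric.isOpen_iff.1 isOpen_interior _ h₁
  obtain ⟨δ₂, hδ₂, hb₂⟩ := Metric.isOpen_iff.1 isOpen_interior _ h₂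
  refine ⟨min δ₁ δ₂ / 2, by positivity, fun ρ hρ z hz => ?_⟩
  obtain ⟨y, s, rfl⟩ := exists_eq_add_smul hu z
  obtain ⟨hy, hs⟩ := (add_smul_mem_drum hu).1 hz
  have hm : 0 < min δ₁ δ₂ := by positivity
  have e : ∀ c : ℝ, dist ((y : E n) + c • u) ((x : E n) + c • u) = dist y x := fun c => by
    rw [dist_add_right]; rfl
  have k₁ : (y : E n) + (t + a) • u ∈ K.set := interior_subset (hb₁ (by
    rw [Metric.mem_ball, e]; linarith [min_le_left δ₁ δ₂]))
  have k₂ : (y : E n) + (t - a) • u ∈ K.set := interior_subset (hb₂ (by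
    rw [Metric.mem_ball, e]; linarith [min_le_right δ₁ δ₂]))
  obtain ⟨hs₁, hs₂⟩ := abs_le.1 hs
  -- These weights combine the heights `t + a` and `t - a` to `s`.
  have := K.convex k₁ k₂ (a := (a + (s - t)) / (2 * a)) (b := (a - (s - t)) / (2 * a))
    (div_nonneg (by linarith) (by linarith)) (div_nonneg (by linarith) (by linarith))
    (by field_simp; ring)
  convert this using 1
  match_scalars <;> field_simp <;> ring

/-! ### From drums to the image of a body -/

section Density

variable {D : Body n → FinMeas n} {φ : ℝ → ℝ}

lemma MeasPreserving.volume_eq (h : MeasPreserving D) (K : Body n) :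
    volume (D K).1 = volume K.set :=
  (congrArg (· (D K).1) (haus_eq_volume n)).symm.trans
    ((h K).trans (congrArg (· K.set) (haus_eq_volume n)))

/-- The radius `a + ρ²/(2a)` bounds the circumradius `√(a² + ρ²)` from above. The enclosing ball
controls heights in the image, and the enclosing cylinder controls the horizontal extent. -/
lemma drum_image_essSubset (hu : ‖u‖ = 1) (hmono : Monotonic D)
    (hcyl : RespectsCylinders (hyp u) D) (hφ : IsBallShift u D φ)
    (x : hyp u) {ρ t a : ℝ} (hρ : 0 < ρ) (ha : 0 < a) :
    (D (drumBody hu x ρ t a hρ ha)).1 ≤ᵐ[volume] drum hu x ρ (φ t) (a + ρ ^ 2 / (2 * a)) := by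
  have hR : 0 < a + ρ ^ 2 / (2 * a) := by positivity
  have hR2 : a ^ 2 + ρ ^ 2 ≤ (a + ρ ^ 2 / (2 * a)) ^ 2 := by
    have : (a + ρ ^ 2 / (2 * a)) ^ 2 = a ^ 2 + ρ ^ 2 + (ρ ^ 2 / (2 * a)) ^ 2 := by field_simp; ring
    rw [this]
    linarith [sq_nonneg (ρ ^ 2 / (2 * a))]
  have h1 : (drumBody hu x ρ t a hρ ha).set ⊆
      (ball ((x : E n) + t • u) (a + ρ ^ 2 / (2 * a)) hR).set := by
    intro z hz
    obtain ⟨y, s, rfl⟩ := exists_eq_add_smul hu z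
    obtain ⟨hy, hs⟩ := (add_smul_mem_drum hu).1 hz
    refine (add_smul_mem_closedBall hu hR.le).2 ?_
    have e1 := pow_le_pow_left₀ dist_nonneg hy 2
    have e2 := pow_le_pow_left₀ (abs_nonneg _) hs 2
    rw [sq_abs] at e2
    linarith
  have h2 : (drumBody hu x ρ t a hρ ha).set ⊆ cylinder (hyp u) (x : E n) ρ := by
    intro z hz
    obtain ⟨y, s, rfl⟩ := exists_eq_add_smul hu z
    exact (add_smul_mem_cylinder hu).2 ((add_smul_mem_drum hu).1 hz).1
  have h3 := essSubset_iff.1 ((hmono _ _ (Filter.Eventually.of_forall h1)).trans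
    (hφ.2 x x.2 t _ hR).le)
  have h4 := essSubset_iff.1 (hcyl _ _ _ hρ (Filter.Eventually.of_forall h2))
  filter_upwards [h3, h4] with z hz3 hz4 hz
  obtain ⟨y, s, rfl⟩ := exists_eq_add_smul hu z
  refine (add_smul_mem_drum hu).2 ⟨(add_smul_mem_cylinder hu).1 (hz4 hz), ?_⟩
  have := (add_smul_mem_closedBall hu hR.le).1 (hz3 hz)
  exact abs_le_of_sq_le_sq (by nlinarith [sq_nonneg (dist y x)]) hR.le

lemma volume_drum_diff_image (hu : ‖u‖ = 1) (hmono : Monotonic D) (hmeas : MeasPreserving D)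
    (hcyl : RespectsCylinders (hyp u) D) (hφ : IsBallShift u D φ)
    (x : hyp u) {ρ t a : ℝ} (hρ : 0 < ρ) (ha : 0 < a) :
    volume (drum hu x ρ (φ t) (a + ρ ^ 2 / (2 * a)) \ (D (drumBody hu x ρ t a hρ ha)).1) =
      volume (Metric.closedBall x ρ) * ENNReal.ofReal (ρ ^ 2 / a) := by
  set C := drum hu x ρ (φ t) (a + ρ ^ 2 / (2 * a))
  set A := (D (drumBody hu x ρ t a hρ ha)).1
  have hsub : A ≤ᵐ[volume] C := drum_image_essSubset hu hmono hcyl hφ x hρ ha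
  have hA : volume A = volume (Metric.closedBall x ρ) * ENNReal.ofReal (2 * a) := by
    rw [hmeas.volume_eq, drumBody_set, volume_drum]
  have hCA : volume (C ∩ A) = volume A := by
    refine measure_congr ?_
    filter_upwards [hsub] with z hz
    exact propext ⟨fun h => h.2, fun h => ⟨hz h, h⟩⟩
  have h := measure_inter_add_sdiff₀ C (D (drumBody hu x ρ t a hρ ha)).nullMeasurableSet
  rw [hCA, hA, volume_drum,
    show 2 * (a + ρ ^ 2 / (2 * a)) = 2 * a + ρ ^ 2 / a by field_simp,
    ENNReal.ofReal_add (by positivity) (by positivity), mul_add] at h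
  exact (ENNReal.add_right_inj
    (ENNReal.mul_ne_top measure_closedBall_lt_top.ne ENNReal.ofReal_ne_top)).1 h

/-- The points outside `D K` have vanishing density at every point of the moved set. -/
lemma volume_closedBall_diff_le (hu : ‖u‖ = 1) (hmono : Monotonic D) (hmeas : MeasPreserving D)
    (hcyl : RespectsCylinders (hyp u) D) (hφ : IsBallShift u D φ) (K : Body n) {z : E n}
    (hz : z ∈ moved u φ K.set) :
    ∃ C : ENNReal, C ≠ ⊤ ∧ ∃ δ > 0, ∀ ρ, 0 < ρ → ρ ≤ δ →
      volume (Metric.closedBall z ρ \ (D K).1) ≤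
        ENNReal.ofReal ρ * C * volume (Metric.closedBall z ρ) := by
  obtain ⟨x, s, rfl⟩ := exists_eq_add_smul hu z
  obtain ⟨t, h₁, h₂⟩ := add_smul_mem_moved.1 hz
  -- Openness of the chord allows a half-height strictly above `|s - φ t|`, leaving vertical room
  -- for a small ball about the point.
  obtain ⟨a, hsa, k₁, k₂⟩ : ∃ a, |s - φ t| < a ∧ t + a ∈ chord u (interior K.set) x ∧
      t - a ∈ chord u (interior K.set) x := by
    have hopen : IsOpen (chord u (interior K.set) x) :=
      isOpen_interior.preimage (continuous_line u x)
    have hb : t + |s - φ t| ∈ chord u (interior K.set) x ∧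
        t - |s - φ t| ∈ chord u (interior K.set) x := by
      rcases abs_cases (s - φ t) with ⟨h, _⟩ | ⟨h, _⟩ <;> rw [h]
      · exact ⟨h₁, h₂⟩
      · rw [← sub_eq_add_neg, sub_neg_eq_add]; exact ⟨h₂, h₁⟩
    have e₁ := (hopen.preimage (continuous_const_add t)).mem_nhds hb.1
    have e₂ := (hopen.preimage (continuous_const.sub continuous_id : Continuous (t - ·))).mem_nhds
      hb.2
    obtain ⟨a, ⟨ha₁, ha₂⟩, ha⟩ := Filter.nonempty_of_mem (Filter.inter_mem
      (nhdsWithin_le_nhds (s := Ioi |s - φ t|) (Filter.inter_mem e₁ e₂)) self_mem_nhdsWithin)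
    exact ⟨a, ha, ha₁, ha₂⟩
  have ha : 0 < a := (abs_nonneg _).trans_lt hsa
  obtain ⟨δ, hδ, hdrum⟩ := exists_drum_subset hu K ha k₁ k₂
  set V := volume (Metric.ball (0 : hyp u) 1)
  set W := volume (Metric.ball (0 : E n) 1)
  have hV : V ≠ ⊤ := measure_ball_lt_top.ne
  have hW : W ≠ ⊤ := measure_ball_lt_top.ne
  have hW0 : W ≠ 0 := (Metric.measure_ball_pos _ _ one_pos).ne'
  -- The missing measure `V ρ^(n-1) · ρ²/a` divided by the ball's measure `W ρ^n` is `ρ` times this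
  -- constant.
  refine ⟨V * ENNReal.ofReal (1 / a) / W,
    ENNReal.div_ne_top (ENNReal.mul_ne_top hV ENNReal.ofReal_ne_top) hW0,
    min δ (a - |s - φ t|), lt_min hδ (by linarith), fun ρ hρ hρδ => ?_⟩
  have hρ₁ := hρδ.trans (min_le_left _ _)
  have hρ₂ := hρδ.trans (min_le_right _ _)
  have hsub : Metric.closedBall ((x : E n) + s • u) ρ ⊆
      drum hu x ρ (φ t) (a + ρ ^ 2 / (2 * a)) := by
    intro w hw
    obtain ⟨y, c, rfl⟩ := exists_eq_add_smul hu w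
    have hw' := (add_smul_mem_closedBall hu hρ.le).1 hw
    have w1 : dist y x ≤ ρ :=
      (sq_le_sq₀ dist_nonneg hρ.le).1 (by nlinarith [sq_nonneg (c - s)])
    have w2 : |c - s| ≤ ρ := abs_le_of_sq_le_sq (by nlinarith [sq_nonneg (dist y x)]) hρ.le
    refine (add_smul_mem_drum hu).2 ⟨w1, ?_⟩
    have w3 := abs_sub_le c s (φ t)
    have w4 : 0 < ρ ^ 2 / (2 * a) := by positivity
    linarith
  have hDK : (D (drumBody hu x ρ t a hρ ha)).1 ≤ᵐ[volume] (D K).1 :=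
    essSubset_iff.1 (hmono _ _ (Filter.Eventually.of_forall (hdrum ρ hρ₁)))
  calc volume (Metric.closedBall ((x : E n) + s • u) ρ \ (D K).1)
      ≤ volume (drum hu x ρ (φ t) (a + ρ ^ 2 / (2 * a)) \ (D (drumBody hu x ρ t a hρ ha)).1) := by
        refine measure_mono_ae ?_
        filter_upwards [hDK] with w hw h
        exact ⟨hsub h.1, fun h' => h.2 (hw h')⟩
    _ = volume (Metric.closedBall x ρ) * ENNReal.ofReal (ρ ^ 2 / a) :=
        volume_drum_diff_image hu hmono hmeas hcyl hφ x hρ ha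
    _ = ENNReal.ofReal ρ * (V * ENNReal.ofReal (1 / a) / W) *
          volume (Metric.closedBall ((x : E n) + s • u) ρ) := by
        have hfin : Module.finrank ℝ (E n) = Module.finrank ℝ (hyp u) + 1 := by
          rw [finrank_hyp hu, finrank_euclideanSpace_fin]
        rw [Measure.addHaar_closedBall _ _ hρ.le, Measure.addHaar_closedBall _ _ hρ.le, hfin,
          show ρ ^ 2 / a = ρ * ρ * (1 / a) by ring, ENNReal.ofReal_mul (by positivity),
          ENNReal.ofReal_mul hρ.le, pow_succ, ENNReal.ofReal_mul (by positivity)]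
        change ENNReal.ofReal (ρ ^ _) * V * _ = _ * (_ * W)
        calc _ = ENNReal.ofReal ρ * (V * ENNReal.ofReal (1 / a)) *
              (ENNReal.ofReal (ρ ^ Module.finrank ℝ (hyp u)) * ENNReal.ofReal ρ) := by ring
          _ = ENNReal.ofReal ρ * (V * ENNReal.ofReal (1 / a) / W * W) *
              (ENNReal.ofReal (ρ ^ Module.finrank ℝ (hyp u)) * ENNReal.ofReal ρ) := by
            rw [ENNReal.div_mul_cancel hW0 hW]
          _ = _ := by ring

/-- The moved set is essentially contained in the image. -/
lemma moved_essSubset (hu : ‖u‖ = 1) (hmono : Monotonic D) (hmeas : MeasPreserving D)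
    (hcyl : RespectsCylinders (hyp u) D) (hφ : IsBallShift u D φ) (K : Body n) :
    moved u φ K.set ≤ᵐ[volume] (D K).1 := by
  rw [ae_le_set]
  set S := moved u φ K.set \ (D K).1
  have hS : NullMeasurableSet S volume :=
    (isOpen_moved u φ K.set).measurableSet.nullMeasurableSet.diff (D K).nullMeasurableSet
  -- Almost every point of `S` is a density point of `S`, whereas the drum estimate makes the
  -- density zero there.
  have hd := (ae_restrict_iff'₀ hS).1 (Besicovitch.ae_tendsto_measure_inter_div volume S)
  refine measure_mono_null (t := {z | ¬ _}) (fun z hz hlim => ?_) hd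
  obtain ⟨C, hC, δ, hδ, hle⟩ := volume_closedBall_diff_le hu hmono hmeas hcyl hφ K hz.1
  have h0 : Filter.Tendsto (fun ρ : ℝ => ENNReal.ofReal ρ * C) (nhdsWithin 0 (Ioi 0))
      (nhds 0) := by
    have h1 : Filter.Tendsto (fun ρ : ℝ => ENNReal.ofReal ρ) (nhdsWithin 0 (Ioi 0)) (nhds 0) := by
      have := (ENNReal.continuous_ofReal.tendsto 0).mono_left
        (nhdsWithin_le_nhds (s := Ioi (0 : ℝ)))
      rwa [ENNReal.ofReal_zero] at this
    simpa using ENNReal.Tendsto.mul_const h1 (Or.inr hC)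
  have h1 := le_of_tendsto_of_tendsto (hlim hz) h0 <| by
    filter_upwards [Ioc_mem_nhdsGT hδ] with ρ hρ
    refine ENNReal.div_le_of_le_mul ((measure_mono ?_).trans (hle ρ hρ.1 hρ.2))
    exact fun w hw => ⟨hw.2, hw.1.2⟩
  simp at h1

lemma essEq_moved (hu : ‖u‖ = 1) (hmono : Monotonic D) (hmeas : MeasPreserving D)
    (hcyl : RespectsCylinders (hyp u) D) (hφ : IsBallShift u D φ) (K : Body n) :
    EssEq (D K).1 (moved u φ K.set) := by
  refine essEq_iff.2 (ae_eq_of_ae_subset_of_measure_ge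
    (moved_essSubset hu hmono hmeas hcyl hφ K) ?_
    (isOpen_moved u φ K.set).measurableSet.nullMeasurableSet (D K).volume_lt_top.ne).symm
  rw [hmeas.volume_eq, volume_moved hu hφ.1]

end Density

/-! ### Properties of the moved set -/

section Converse

variable {D : Body n → FinMeas n} {φ : ℝ → ℝ}

lemma monotonic_of_essEq_moved (h : ∀ K, EssEq (D K).1 (moved u φ K.set)) : Monotonic D :=
  fun K L hKL => (h K).le.trans <|
    (moved_mono (Body.subset_of_essSubset L.isClosed hKL)).eventuallyLE.trans (h L).symm.le

lemma measPreserving_of_essEq_moved (hu : ‖u‖ = 1) (hφ : LipschitzWith 1 φ)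
    (h : ∀ K, EssEq (D K).1 (moved u φ K.set)) : MeasPreserving D := fun K => by
  rw [measure_congr (h K), haus_eq_volume, volume_moved hu hφ]

lemma respectsCylinders_of_essEq_moved (hu : ‖u‖ = 1)
    (h : ∀ K, EssEq (D K).1 (moved u φ K.set)) : RespectsCylinders (hyp u) D := by
  intro K c r _ hK
  refine (h K).le.trans (Filter.Eventually.of_forall fun z hz => ?_)
  obtain ⟨x, s, rfl⟩ := exists_eq_add_smul hu z
  obtain ⟨t, ht, -⟩ := add_smul_mem_moved.1 hz
  have h1 := Body.subset_of_essSubset (isClosed_cylinder hu c r) hK (interior_subset ht)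
  refine (mem_cylinder_iff hu).2 ?_
  rw [foot_add_smul]
  rwa [mem_cylinder_iff hu, foot_add_smul] at h1

lemma ball_subset_moved (hu : ‖u‖ = 1) (φ : ℝ → ℝ) (x : hyp u) (t r : ℝ) (hr : 0 < r) :
    Metric.ball ((x : E n) + φ t • u) r ⊆
      moved u φ (Metric.closedBall ((x : E n) + t • u) r) := by
  intro z hz
  obtain ⟨y, s, rfl⟩ := exists_eq_add_smul hu z
  rw [add_smul_mem_ball hu hr.le] at hz
  refine add_smul_mem_moved.2 ⟨t, ?_, ?_⟩ <;>
  · refine Metric.ball_subset_interior_closedBall ((add_smul_mem_ball hu hr.le).2 ?_)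
    ring_nf at hz ⊢
    exact hz

/-- The moved set of a ball contains the open ball about the shifted center and has the same finite
volume, so they agree essentially. -/
lemma isBallShift_of_essEq_moved (hn : 2 ≤ n) (hu : ‖u‖ = 1) (hφ : LipschitzWith 1 φ)
    (h : ∀ K, EssEq (D K).1 (moved u φ K.set)) : IsBallShift u D φ := by
  have := nontrivial_of_two_le hn
  refine ⟨hφ, fun x hx t r hr => (h _).trans (essEq_iff.2 ?_)⟩
  have hvol := volume_moved hu hφ (ball (x + t • u) r hr)
  have h1 : Metric.ball (x + φ t • u) r =ᵐ[volume] moved u φ (ball (x + t • u) r hr).set := by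
    refine ae_eq_of_subset_of_measure_ge (ball_subset_moved hu φ ⟨x, hx⟩ t r hr) ?_
      measurableSet_ball.nullMeasurableSet ?_
    · rw [hvol, ball_set, Measure.addHaar_closedBall_eq_addHaar_ball,
        Measure.addHaar_ball_center, Measure.addHaar_ball_center volume (x + φ t • u)]
    · rw [hvol]
      exact measure_closedBall_lt_top.ne
  have h2 : Metric.ball (x + φ t • u) r =ᵐ[volume] Metric.closedBall (x + φ t • u) r :=
    ae_eq_of_subset_of_measure_ge Metric.ball_subset_closedBall
      (Measure.addHaar_closedBall_eq_addHaar_ball _ _ _).le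
      measurableSet_ball.nullMeasurableSet measure_closedBall_lt_top.ne
  exact h1.symm.trans h2

lemma IsBallShift.mapsBallsToBalls (hu : ‖u‖ = 1) (h : IsBallShift u D φ) :
    MapsBallsToBalls D := by
  intro z r hr
  obtain ⟨x, t, rfl⟩ := exists_eq_add_smul hu z
  exact ⟨_, r, hr, h.2 x x.2 t r hr⟩

end Converse

end ChordMovement

end

theorem mainTheorem5 (n : ℕ) (hn : 2 ≤ n) (u : ChordMovement.E n) (hu : ‖u‖ = 1)
    (D : ChordMovement.Body n → ChordMovement.FinMeas n)
    (φ : ℝ → ℝ) (hφ : LipschitzWith 1 φ) :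
    List.TFAE [
      (ChordMovement.Monotonic D ∧ ChordMovement.MeasPreserving D ∧
        ChordMovement.RespectsCylinders (ChordMovement.hyp u) D ∧
        ChordMovement.MapsBallsToBalls D) ∧ φ = ChordMovement.ballShift u D,
      ∀ K : ChordMovement.Body n,
        ChordMovement.EssEq (D K).1
          (⋃ t : ℝ, interior
            (ChordMovement.translate (ChordMovement.symPart u K.set t) (φ t • u))),
      ∀ K : ChordMovement.Body n,
        ∀ᵐ x : ChordMovement.hyp u ∂(ChordMovement.haus (n - 1)),
          ((D K).1 ∩ ChordMovement.perpLine (ChordMovement.hyp u) (x : ChordMovement.E n) :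
              Set (ChordMovement.E n))
            =ᵐ[ChordMovement.haus 1]
          (ChordMovement.translate
            (K.set ∩ ChordMovement.perpLine (ChordMovement.hyp u) (x : ChordMovement.E n))
            ((φ (ChordMovement.midHeight u K.set x) - ChordMovement.midHeight u K.set x) • u) :
              Set (ChordMovement.E n))] := by
  tfae_have 2 ↔ 3 :=
    forall_congr' fun K => ChordMovement.essEq_moved_iff hu hφ K (D K).nullMeasurableSet
  tfae_have 1 → 2 := by
    rintro ⟨⟨hmono, hmeas, hcyl, hball⟩, rfl⟩ K
    exact ChordMovement.essEq_moved hu hmono hmeas hcyl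
      (ChordMovement.isBallShift_ballShift hn hu hmono hmeas hcyl hball) K
  tfae_have 2 → 1 := by
    intro h
    have hs := ChordMovement.isBallShift_of_essEq_moved hn hu hφ h
    exact ⟨⟨ChordMovement.monotonic_of_essEq_moved h,
      ChordMovement.measPreserving_of_essEq_moved hu hφ h,
      ChordMovement.respectsCylinders_of_essEq_moved hu h, hs.mapsBallsToBalls hu⟩,
      hs.eq_ballShift hn hu⟩
  tfae_finish
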